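/- Let $p,q\ge 0$ be integers. Let $Q(x)=x_0^2+\dots+x_p^2-x_{p+1}^2-\dots-x_{p+q}^2$ on $\mathbb{R}^{p+1+q}$, let $G=O(p+1,q)=\{g\in GL(p+1+q,\mathbb{R}) : Q(gx)=Q(x)\ \text{for all } x\}$, and let $H=O(p,q)$ be the stabilizer $\{g\in G : ge_0=e_0\}$ of the first standard basis vector $e_0$. Let $\theta g={}^t g^{-1}$ be the standard Cartan involution, $\mathfrak g$ and $\mathfrak h$ the Lie algebras of $G$ and $H$, $K=\{g\in G:\theta g=g\}\ (\cong O(p+1)\times O(q))$, and $\mathfrak p=\{X\in\mathfrak g: {}^tX=X\}$. The Cartan motion group of $G$ is the semidirect product $G_\theta=K\ltimes_{\mathrm{Ad}}\mathfrak p$, with multiplication $(k_1,X_1)(k_2,X_2)=(k_1k_2,\,X_1+k_1X_2k_1^{-1})$ and the product topology, and $H_\theta=(K\cap H)\ltimes_{\mathrm{Ad}}(\mathfrak p\cap\mathfrak h)\subset G_\theta$. The homogeneous space $G_\theta/H_\theta$ is the tangential symmetric space of $O(p+1,q)/O(p,q)$. It is said to admit a compact Clifford–Klein form if there is a discrete subgroup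 $\Gamma\subset G_\theta$ which acts properly discontinuously and freely on $G_\theta/H_\theta$ by left translations and for which the double coset space $\Gamma\backslash G_\theta/H_\theta$ is compact in the quotient topology. **Lemma.** The following two conditions are equivalent: (i) the tangential symmetric space $G_\theta/H_\theta$ of $O(p+1,q)/O(p,q)$ admits a compact Clifford–Klein form; (ii) there exists a bilinear map $f:\mathbb{R}^{p+1}\times\mathbb{R}^q\to\mathbb{R}^q$ such that $f(v,w)=0$ only if $v=0$ or $w=0$. -/

import Mathlib

noncomputable section

namespace TangentialSpaceForm

open Matrix

/-! ## Compact Clifford–Klein forms -/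

section CliffordKlein

variable {G : Type*} [Group G] [TopologicalSpace G]

/-- `Γ` is a discontinuous group for the homogeneous space `G ⧸ H`: it is a discrete subgroup of `G`
which acts on `G ⧸ H` by left translations properly discontinuously and freely. -/
structure IsDiscontinuousGroup (Γ H : Subgroup G) : Prop where
  discrete : DiscreteTopology Γ
  properlyDiscontinuous : ProperlyDiscontinuousSMul Γ (G ⧸ H)
  free : ∀ (γ : Γ) (x : G ⧸ H), γ • x = x → γ = 1

/-- `G ⧸ H` admits a compact Clifford–Klein form: for some discontinuous group `Γ` for `G ⧸ H`, the
double coset space `Γ \ G ⧸ H`, with its quotient topology, is compact. -/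
def AdmitsCompactCliffordKleinForm (H : Subgroup G) : Prop :=
  ∃ Γ : Subgroup G, IsDiscontinuousGroup Γ H ∧
    CompactSpace (Quotient (MulAction.orbitRel Γ (G ⧸ H)))

end CliffordKlein

/-! ## Tangential homogeneous spaces of linear groups

`G` is a subgroup of `GL n ℝ`; the definitions are meant for a closed `G` that is stable under the
Cartan involution `θ g = (gᵀ)⁻¹`. -/

section CartanMotion

variable {n : Type*} [Fintype n] [DecidableEq n]

/-- The Lie algebra of a linear Lie group `G`, namely the set of the matrices `X` with
`exp (t X) ∈ G` for all real `t`. For a closed `G` this set is itself a linear subspace; the span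
only bundles it as a `Submodule`. -/
def lieAlgebra (G : Subgroup (GL n ℝ)) : Submodule ℝ (Matrix n n ℝ) :=
  Submodule.span ℝ {X | ∀ t : ℝ, ∃ g ∈ G, (g : Matrix n n ℝ) = NormedSpace.exp (t • X)}

/-- `K`: the subgroup of `G` fixed by the Cartan involution `θ g = (gᵀ)⁻¹`. -/
def fixedSubgroup (G : Subgroup (GL n ℝ)) : Subgroup (GL n ℝ) where
  carrier := {k | k ∈ G ∧ (k : Matrix n n ℝ)ᵀ = ((k⁻¹ : GL n ℝ) : Matrix n n ℝ)}
  mul_mem' := by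
    rintro a b ⟨ha, ha'⟩ ⟨hb, hb'⟩
    refine ⟨G.mul_mem ha hb, ?_⟩
    rw [_root_.mul_inv_rev, Units.val_mul, Units.val_mul, Matrix.transpose_mul, ha', hb']
  one_mem' := ⟨G.one_mem, by simp⟩
  inv_mem' := by
    rintro a ⟨ha, ha'⟩
    refine ⟨G.inv_mem ha, ?_⟩
    rw [← ha', Matrix.transpose_transpose, inv_inv]

/-- `𝔭`: the `-1`-eigenspace of the differential `X ↦ -Xᵀ` of `θ` on the Lie algebra of `G`, so that
`𝔤 = 𝔨 + 𝔭` is the Cartan decomposition. -/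
def symmetricPart (G : Subgroup (GL n ℝ)) : Submodule ℝ (Matrix n n ℝ) where
  carrier := {X | X ∈ lieAlgebra G ∧ Xᵀ = X}
  add_mem' := by
    rintro X Y ⟨hX, hX'⟩ ⟨hY, hY'⟩
    exact ⟨add_mem hX hY, by rw [Matrix.transpose_add, hX', hY']⟩
  zero_mem' := ⟨zero_mem _, Matrix.transpose_zero⟩
  smul_mem' := by
    rintro c X ⟨hX, hX'⟩
    exact ⟨Submodule.smul_mem _ c hX, by rw [Matrix.transpose_smul, hX']⟩

theorem conj_mem_lieAlgebra {G : Subgroup (GL n ℝ)} {g : GL n ℝ} (hg : g ∈ G)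
    {X : Matrix n n ℝ} (hX : X ∈ lieAlgebra G) :
    (g : Matrix n n ℝ) * X * ((g⁻¹ : GL n ℝ) : Matrix n n ℝ) ∈ lieAlgebra G := by
  induction hX using Submodule.span_induction with
  | mem X hX =>
    refine Submodule.subset_span fun t => ?_
    obtain ⟨h, hh, e⟩ := hX t
    refine ⟨g * h * g⁻¹, G.mul_mem (G.mul_mem hg hh) (G.inv_mem hg), ?_⟩
    rw [Units.val_mul, Units.val_mul, e, ← Matrix.exp_units_conj]
    simp
  | zero => simp
  | add X Y _ _ hX hY => rw [mul_add, add_mul]; exact add_mem hX hY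
  | smul c X _ hX => rw [mul_smul_comm, smul_mul_assoc]; exact Submodule.smul_mem _ c hX

theorem conj_mem_symmetricPart {G : Subgroup (GL n ℝ)} {k : GL n ℝ} (hk : k ∈ fixedSubgroup G)
    {X : Matrix n n ℝ} (hX : X ∈ symmetricPart G) :
    (k : Matrix n n ℝ) * X * ((k⁻¹ : GL n ℝ) : Matrix n n ℝ) ∈ symmetricPart G := by
  refine ⟨conj_mem_lieAlgebra hk.1 hX.1, ?_⟩
  rw [← hk.2, Matrix.transpose_mul, Matrix.transpose_mul, Matrix.transpose_transpose, hX.2,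
    mul_assoc]

/-- The adjoint action `Ad k : X ↦ k X k⁻¹` of `k ∈ K` on `𝔭`. -/
def Ad (G : Subgroup (GL n ℝ)) (k : fixedSubgroup G) : symmetricPart G →ₗ[ℝ] symmetricPart G where
  toFun X := ⟨(k : GL n ℝ) * X * ((k : GL n ℝ)⁻¹ : GL n ℝ), conj_mem_symmetricPart k.2 X.2⟩
  map_add' X Y := by ext1; simp [mul_add, add_mul]
  map_smul' c X := by ext1; simp

theorem Ad_one {G : Subgroup (GL n ℝ)} (X : symmetricPart G) : Ad G 1 X = X := by
  ext1; simp [Ad]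

theorem Ad_mul {G : Subgroup (GL n ℝ)} (k l : fixedSubgroup G) (X : symmetricPart G) :
    Ad G (k * l) X = Ad G k (Ad G l X) := by
  ext1; simp only [Ad, LinearMap.coe_mk, AddHom.coe_mk, Subgroup.coe_mul, _root_.mul_inv_rev,
    Units.val_mul, mul_assoc]

/-- The adjoint action of `K` on the vector group `𝔭`, written multiplicatively. -/
def adjointAction (G : Subgroup (GL n ℝ)) :
    fixedSubgroup G →* MulAut (Multiplicative (symmetricPart G)) where
  toFun k :=
    { toFun := fun X => Multiplicative.ofAdd (Ad G k X.toAdd)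
      invFun := fun X => Multiplicative.ofAdd (Ad G k⁻¹ X.toAdd)
      left_inv := fun X => by
        dsimp only
        rw [toAdd_ofAdd, ← Ad_mul, inv_mul_cancel, Ad_one, ofAdd_toAdd]
      right_inv := fun X => by
        dsimp only
        rw [toAdd_ofAdd, ← Ad_mul, mul_inv_cancel, Ad_one, ofAdd_toAdd]
      map_mul' := fun X Y => by rw [toAdd_mul, map_add, ofAdd_add] }
  map_one' := by
    ext1 X
    exact congrArg Multiplicative.ofAdd (Ad_one X.toAdd)
  map_mul' k l := by
    ext1 X
    exact congrArg Multiplicative.ofAdd (Ad_mul k l X.toAdd)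

/-- The Cartan motion group `G_θ = K ⋉_Ad 𝔭` of `G`. An element `x` has the components
`x.left ∈ 𝔭` and `x.right ∈ K`, and the product is
`(X₁, k₁) (X₂, k₂) = (X₁ + Ad k₁ X₂, k₁ k₂)`. -/
def CartanMotionGroup (G : Subgroup (GL n ℝ)) : Type _ :=
  Multiplicative (symmetricPart G) ⋊[adjointAction G] fixedSubgroup G

instance (G : Subgroup (GL n ℝ)) : Group (CartanMotionGroup G) :=
  inferInstanceAs (Group (Multiplicative (symmetricPart G) ⋊[adjointAction G] fixedSubgroup G))

/-- The topology of the Cartan motion group is the product topology of `𝔭 × K`. -/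
instance (G : Subgroup (GL n ℝ)) : TopologicalSpace (CartanMotionGroup G) :=
  TopologicalSpace.induced
    (fun x => ((x.left.toAdd, x.right) : symmetricPart G × fixedSubgroup G)) inferInstance

/-- For a subgroup `H` of `G`, the Cartan motion group `H_θ = (K ∩ H) ⋉_Ad (𝔭 ∩ 𝔥)` of `H`, regarded
as a subgroup of `G_θ`. The tangential homogeneous space of `G ⧸ H` is
`CartanMotionGroup G ⧸ tangentialSubgroup G H`. -/
def tangentialSubgroup (G H : Subgroup (GL n ℝ)) : Subgroup (CartanMotionGroup G) where
  carrier := {x | (x.right : GL n ℝ) ∈ H ∧ (x.left.toAdd : Matrix n n ℝ) ∈ lieAlgebra H}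
  mul_mem' := by
    rintro a b ⟨ha, ha'⟩ ⟨hb, hb'⟩
    exact ⟨H.mul_mem ha hb, add_mem ha' (conj_mem_lieAlgebra ha hb')⟩
  one_mem' := ⟨H.one_mem, zero_mem _⟩
  inv_mem' := by
    rintro a ⟨ha, ha'⟩
    exact ⟨H.inv_mem ha, conj_mem_lieAlgebra (H.inv_mem ha) (neg_mem ha')⟩

end CartanMotion

/-! ## The indefinite orthogonal groups -/

/-- The quadratic form `x₁² + ⋯ + x_p² - x_{p+1}² - ⋯ - x_{p+q}²` on `ℝ^{p+q}`. -/
def indefiniteForm (p q : ℕ) (x : Fin p ⊕ Fin q → ℝ) : ℝ :=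
  ∑ i, x (Sum.inl i) ^ 2 - ∑ j, x (Sum.inr j) ^ 2

/-- The indefinite orthogonal group `O(p,q)`. -/
def indefiniteOrthogonal (p q : ℕ) : Subgroup (GL (Fin p ⊕ Fin q) ℝ) where
  carrier := {g | ∀ x, indefiniteForm p q ((g : Matrix (Fin p ⊕ Fin q) (Fin p ⊕ Fin q) ℝ) *ᵥ x) = indefiniteForm p q x}
  mul_mem' := by
    intro a b ha hb x
    rw [Units.val_mul, ← Matrix.mulVec_mulVec, ha, hb]
  one_mem' x := by rw [Units.val_one, Matrix.one_mulVec]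
  inv_mem' := by
    intro a ha x
    rw [← ha, Matrix.mulVec_mulVec, ← Units.val_mul, mul_inv_cancel, Units.val_one,
      Matrix.one_mulVec]

/-- `O(p,q)` as the subgroup of `O(p+1,q)` fixing the first standard basis vector `e₀`. -/
def indefiniteOrthogonalStabilizer (p q : ℕ) : Subgroup (GL (Fin (p + 1) ⊕ Fin q) ℝ) where
  carrier := {g | g ∈ indefiniteOrthogonal (p + 1) q ∧
    (g : Matrix (Fin (p + 1) ⊕ Fin q) (Fin (p + 1) ⊕ Fin q) ℝ) *ᵥ Pi.single (Sum.inl 0) 1 =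
      Pi.single (Sum.inl 0) 1}
  mul_mem' := by
    rintro a b ⟨ha, ha'⟩ ⟨hb, hb'⟩
    exact ⟨mul_mem ha hb, by rw [Units.val_mul, ← Matrix.mulVec_mulVec, hb', ha']⟩
  one_mem' := ⟨one_mem _, by rw [Units.val_one, Matrix.one_mulVec]⟩
  inv_mem' := by
    rintro a ⟨ha, ha'⟩
    refine ⟨inv_mem ha, ?_⟩
    conv_lhs => rw [← ha']
    rw [Matrix.mulVec_mulVec, ← Units.val_mul, inv_mul_cancel, Units.val_one, Matrix.one_mulVec]

end TangentialSpaceForm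

end

/-!
Modulo the compact group `K`, the group `G_θ` is the vector group `𝔭`. The translation parts of a
discontinuous group with compact quotient therefore form a coarse complement of all the subspaces
`Ad k (𝔭 ∩ 𝔥)` of `𝔭` at once, uniformly in `k ∈ K`.
Rescaling to the asymptotic cone turns this coarse complement into the image of a Lipschitz map, and
differentiating that map at a point given by Rademacher's theorem turns it into a linear subspace
`W` complementary to every `Ad k (𝔭 ∩ 𝔥)`. Conversely, a lattice in such a `W` is a discontinuous
group with compact quotient.

For `O(p+1,q)` and `O(p,q)`, `𝔭` is the space of the linear maps `ℝ^{p+1} → ℝ^q`, and the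
`Ad k (𝔭 ∩ 𝔥)` are the subspaces `{φ | φ v = 0}` with `v ≠ 0`. A subspace `W` is a complement of all
of them if and only if the evaluation `W → ℝ^q` at each `v ≠ 0` is bijective. Hence `W ≅ ℝ^q`, and
evaluation is a bilinear map `ℝ^{p+1} × W → ℝ^q` without zero divisors.
-/

noncomputable section

namespace TangentialSpaceForm

section CoarseComplements

open Filter Topology Module

variable {E F ι : Type*} [NormedAddCommGroup E] [NormedSpace ℝ E]
  [NormedAddCommGroup F] [NormedSpace ℝ F]

/-- `T` is a coarse common complement of the subspaces `U i`: uniformly in `i`, every point of `E`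
is at bounded distance from `T + U i`, and two points of `T` that are close modulo `U i` are close.
It is the trace on `E` of a discrete group acting cocompactly and properly. -/
structure IsCoarseCommonComplement (T : Set E) (U : ι → Submodule ℝ E) : Prop where
  exists_norm_sub_sub_le : ∃ R, ∀ i x, ∃ t ∈ T, ∃ u ∈ U i, ‖x - t - u‖ ≤ R
  exists_norm_sub_le : ∀ r, ∃ D, ∀ i, ∀ t ∈ T, ∀ t' ∈ T, ∀ u ∈ U i,
    ‖t - t' - u‖ ≤ r → ‖t - t'‖ ≤ D

namespace IsCoarseCommonComplement

variable {T : Set E} {U : ι → Submodule ℝ E}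

-- Subdivide the segment from `x` to `t'` into unit steps and follow it by points of `T`.
theorem norm_sub_le_of_dist_le {V : Submodule ℝ E} {R D : ℝ}
    (hR : ∀ x, ∃ t ∈ T, ∃ u ∈ V, ‖x - t - u‖ ≤ R)
    (hD : ∀ t ∈ T, ∀ t' ∈ T, ∀ u ∈ V, ‖t - t' - u‖ ≤ 2 * R + 1 → ‖t - t'‖ ≤ D)
    (n : ℕ) {t t' x u : E} (ht : t ∈ T) (ht' : t' ∈ T) (hu : u ∈ V) (hx : ‖x - t - u‖ ≤ R)
    (hn : dist x t' ≤ n) : ‖t - t'‖ ≤ (n + 1) * D := by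
  induction n generalizing t x u with
  | zero =>
    obtain rfl : x = t' := dist_le_zero.mp (by simpa using hn)
    have hclose : ‖t - x - -u‖ ≤ R := by
      rwa [← norm_neg, show -(t - x - -u) = x - t - u by abel]
    simpa using hD t ht x ht' _ (neg_mem hu) (by linarith [norm_nonneg (t - x - -u)])
  | succ n ih =>
    obtain ⟨y, hxy, hyt⟩ := exists_dist_le_le zero_le_one n.cast_nonneg (by exact_mod_cast hn)
    obtain ⟨s, hs, v, hv, hy⟩ := hR y
    have hclose : ‖t - s - (v - u)‖ ≤ 2 * R + 1 := calc
      ‖t - s - (v - u)‖ = ‖(x - y) - (x - t - u) + (y - s - v)‖ := by congr 1; abel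
      _ ≤ ‖x - y‖ + ‖x - t - u‖ + ‖y - s - v‖ :=
        (norm_add_le _ _).trans (add_le_add_left (norm_sub_le _ _) _)
      _ ≤ 2 * R + 1 := by rw [dist_eq_norm] at hxy; linarith
    have hts := hD t ht s hs _ (sub_mem hv hu) hclose
    calc ‖t - t'‖ ≤ ‖t - s‖ + ‖s - t'‖ := norm_sub_le_norm_sub_add_norm_sub _ _ _
      _ ≤ D + (n + 1) * D := add_le_add hts (ih hs hv hy hyt)
      _ = ((n + 1 : ℕ) + 1) * D := by push_cast; ring

theorem exists_norm_sub_le_mul (h : IsCoarseCommonComplement T U) :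
    ∃ C, 0 ≤ C ∧ ∀ i, ∀ t ∈ T, ∀ t' ∈ T, ∀ u ∈ U i, ‖t - t'‖ ≤ C * (‖t - t' - u‖ + 1) := by
  obtain ⟨R, hR⟩ := h.exists_norm_sub_sub_le
  obtain ⟨D, hD⟩ := h.exists_norm_sub_le (2 * max R 0 + 1)
  refine ⟨2 * max D 0, by positivity, fun i t ht t' ht' u hu => ?_⟩
  have hchain := norm_sub_le_of_dist_le (R := max R 0) (D := max D 0)
    (fun x => (hR i x).imp fun s ⟨hs, v, hv, hx⟩ => ⟨hs, v, hv, hx.trans (le_max_left _ _)⟩)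
    (fun s hs s' hs' v hv hle => (hD i s hs s' hs' v hv hle).trans (le_max_left _ _))
    ⌈‖t - t' - u‖⌉₊ (x := t - u) (u := -u) ht ht' (neg_mem hu) (by simp)
    (by rw [dist_eq_norm, sub_right_comm]; exact Nat.le_ceil _)
  nlinarith [Nat.ceil_lt_add_one (norm_nonneg (t - t' - u)), le_max_right D 0,
    norm_nonneg (t - t' - u)]

end IsCoarseCommonComplement

theorem exists_tendsto_inv_smul_smul [ProperSpace F] {ψ : E → F} {A B : ℝ}
    (hψ : ∀ x, ‖ψ x‖ ≤ A * ‖x‖ + B) :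
    ∃ (l : Filter ℝ) (φ : E → F), l.NeBot ∧ l ≤ atTop ∧
      ∀ x, Tendsto (fun c : ℝ => c⁻¹ • ψ (c • x)) l (𝓝 (φ x)) := by
  let l : Ultrafilter ℝ := Ultrafilter.of atTop
  have hl : (l : Filter ℝ) ≤ atTop := Ultrafilter.of_le _
  suffices ∀ x, ∃ y, Tendsto (fun c : ℝ => c⁻¹ • ψ (c • x)) l (𝓝 y) by
    choose φ hφ using this
    exact ⟨l, φ, inferInstance, hl, hφ⟩
  intro x
  have hbdd : ∀ᶠ c : ℝ in atTop, c⁻¹ • ψ (c • x) ∈ Metric.closedBall (0 : F) (A * ‖x‖ + |B|) := by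
    filter_upwards [eventually_ge_atTop (1 : ℝ)] with c hc
    have hc0 : 0 < c := one_pos.trans_le hc
    rw [mem_closedBall_zero_iff, norm_smul, Real.norm_of_nonneg (inv_nonneg.mpr hc0.le),
      inv_mul_le_iff₀ hc0]
    calc ‖ψ (c • x)‖ ≤ A * ‖c • x‖ + B := hψ _
      _ = c * (A * ‖x‖) + B := by rw [norm_smul, Real.norm_of_nonneg hc0.le]; ring
      _ ≤ c * (A * ‖x‖ + |B|) := by nlinarith [le_abs_self B, abs_nonneg B]
  obtain ⟨y, -, hy⟩ := (isCompact_closedBall (0 : F) (A * ‖x‖ + |B|)).ultrafilter_le_nhds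
    (l.map fun c => c⁻¹ • ψ (c • x)) (le_principal_iff.mpr (hl hbdd))
  exact ⟨y, hy⟩

theorem inv_smul_sub_eq {c : ℝ} (hc : c ≠ 0) (x u : E) : c⁻¹ • x - u = c⁻¹ • (x - c • u) := by
  rw [smul_sub, inv_smul_smul₀ hc]

section AsymptoticCone

variable {l : Filter ℝ} [l.NeBot] {V : Submodule ℝ E}

theorem sub_mem_of_tendsto_inv_smul_smul (hl : l ≤ atTop) {ψ υ : E → E} {x y : E} {B : ℝ}
    (hV : IsClosed (V : Set E)) (hυ : ∀ x, υ x ∈ V) (hB : ∀ x, ‖x - ψ x - υ x‖ ≤ B)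
    (hy : Tendsto (fun c : ℝ => c⁻¹ • ψ (c • x)) l (𝓝 y)) : y - x ∈ V := by
  have herror : Tendsto (fun c : ℝ => c⁻¹ • (c • x - ψ (c • x) - υ (c • x))) l (𝓝 0) :=
    (tendsto_inv_atTop_zero.mono_left hl).zero_smul_isBoundedUnder_le
      (isBoundedUnder_of ⟨B, fun c => hB (c • x)⟩)
  have hlim : Tendsto (fun c : ℝ => -(c⁻¹ • υ (c • x))) l (𝓝 (y - x)) := by
    have := (herror.add hy).sub_const x
    rw [zero_add] at this
    refine this.congr' ?_
    filter_upwards [hl (eventually_gt_atTop 0)] with c hc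
    simp only [smul_sub, inv_smul_smul₀ hc.ne']
    abel
  exact hV.mem_of_tendsto hlim (.of_forall fun c => neg_mem (V.smul_mem _ (hυ _)))

theorem norm_sub_le_of_tendsto_inv_smul_smul (hl : l ≤ atTop) {ψ : F → E} {x x' : F} {y y' u : E}
    {C : ℝ} (hψ : ∀ x x', ∀ u ∈ V, ‖ψ x - ψ x'‖ ≤ C * (‖ψ x - ψ x' - u‖ + 1))
    (hy : Tendsto (fun c : ℝ => c⁻¹ • ψ (c • x)) l (𝓝 y))
    (hy' : Tendsto (fun c : ℝ => c⁻¹ • ψ (c • x')) l (𝓝 y')) (hu : u ∈ V) :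
    ‖y - y'‖ ≤ C * ‖y - y' - u‖ := by
  have hdiff : Tendsto (fun c : ℝ => c⁻¹ • (ψ (c • x) - ψ (c • x'))) l (𝓝 (y - y')) := by
    simpa only [smul_sub] using hy.sub hy'
  have hinv : Tendsto (fun c : ℝ => c⁻¹) l (𝓝 0) := tendsto_inv_atTop_zero.mono_left hl
  have hright := ((hdiff.sub_const u).norm.add hinv).const_mul C
  rw [add_zero] at hright
  refine le_of_tendsto_of_tendsto hdiff.norm hright ?_
  filter_upwards [hl (eventually_gt_atTop 0)] with c hc
  calc ‖c⁻¹ • (ψ (c • x) - ψ (c • x'))‖ = c⁻¹ * ‖ψ (c • x) - ψ (c • x')‖ := by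
        rw [norm_smul, Real.norm_of_nonneg (inv_nonneg.mpr hc.le)]
    _ ≤ c⁻¹ * (C * (‖ψ (c • x) - ψ (c • x') - c • u‖ + 1)) := by
        gcongr
        exact hψ _ _ _ (V.smul_mem c hu)
    _ = C * (‖c⁻¹ • (ψ (c • x) - ψ (c • x')) - u‖ + c⁻¹) := by
        rw [inv_smul_sub_eq hc.ne', norm_smul, Real.norm_of_nonneg (inv_nonneg.mpr hc.le)]
        ring

end AsymptoticCone

namespace IsCoarseCommonComplement

variable {T : Set E} {U : ι → Submodule ℝ E}

theorem exists_coarse_section (h : IsCoarseCommonComplement T U) (i₀ : ι) :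
    ∃ (ψ υ : E → E) (A B : ℝ), (∀ x, ψ x ∈ T) ∧ (∀ x, υ x ∈ U i₀) ∧
      (∀ x, ‖x - ψ x - υ x‖ ≤ B) ∧ ∀ x, ‖ψ x‖ ≤ A * ‖x‖ + B := by
  obtain ⟨R, hR⟩ := h.exists_norm_sub_sub_le
  obtain ⟨C, hC, hT⟩ := h.exists_norm_sub_le_mul
  choose ψ hψ υ hυ hR using hR i₀
  have hgrowth (x : E) : ‖ψ x‖ ≤ C * ‖x‖ + (C * (2 * R + 1) + ‖ψ 0‖) := by
    have hclose : ‖ψ x - ψ 0 - (υ 0 - υ x)‖ ≤ ‖x‖ + 2 * R := calc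
      ‖ψ x - ψ 0 - (υ 0 - υ x)‖ = ‖x - (x - ψ x - υ x) + (0 - ψ 0 - υ 0)‖ := by congr 1; abel
      _ ≤ ‖x‖ + ‖x - ψ x - υ x‖ + ‖0 - ψ 0 - υ 0‖ :=
        (norm_add_le _ _).trans (add_le_add_left (norm_sub_le _ _) _)
      _ ≤ ‖x‖ + 2 * R := by linarith [hR x, hR 0]
    have := hT i₀ _ (hψ x) _ (hψ 0) _ (sub_mem (hυ 0) (hυ x))
    nlinarith [norm_sub_norm_le (ψ x) (ψ 0)]
  exact ⟨ψ, υ, C, max R (C * (2 * R + 1) + ‖ψ 0‖), hψ, hυ, fun x => (hR x).trans (le_max_left _ _),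
    fun x => (hgrowth x).trans (add_le_add_right (le_max_right _ _) _)⟩

variable [FiniteDimensional ℝ E]

-- `φ` is the section that `T` induces on the asymptotic cone of `E`.
theorem exists_asymptotic_section (h : IsCoarseCommonComplement T U) (i₀ : ι) :
    ∃ (C : ℝ) (φ : E → E), 0 ≤ C ∧ (∀ x, φ x - x ∈ U i₀) ∧
      ∀ i, ∀ u ∈ U i, ∀ x y, ‖φ x - φ y‖ ≤ C * ‖φ x - φ y - u‖ := by
  obtain ⟨C, hC, hT⟩ := h.exists_norm_sub_le_mul
  obtain ⟨ψ, υ, A, B, hψ, hυ, hB, hgrowth⟩ := h.exists_coarse_section i₀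
  obtain ⟨l, φ, _, hl, hφ⟩ := exists_tendsto_inv_smul_smul hgrowth
  exact ⟨C, φ, hC,
    fun x => sub_mem_of_tendsto_inv_smul_smul hl (U i₀).closed_of_finiteDimensional hυ hB (hφ x),
    fun i u hu x y => norm_sub_le_of_tendsto_inv_smul_smul hl
      (fun x y => hT i _ (hψ x) _ (hψ y)) (hφ x) (hφ y) hu⟩

-- Differentiate the asymptotic section at a point given by Rademacher's theorem.
theorem exists_linear_section (h : IsCoarseCommonComplement T U) (i₀ : ι) :
    ∃ (C : ℝ) (L : E →L[ℝ] E), (∀ v, L v - v ∈ U i₀) ∧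
      ∀ i, ∀ u ∈ U i, ∀ v, ‖L v‖ ≤ C * ‖L v - u‖ := by
  obtain ⟨C, φ, hC, hsection, hφ⟩ := h.exists_asymptotic_section i₀
  have hlip : LipschitzWith ⟨C, hC⟩ φ := LipschitzWith.of_dist_le_mul fun x y => by
    have := hφ i₀ _ (sub_mem (hsection x) (hsection y)) x y
    rwa [show φ x - φ y - (φ x - x - (φ y - y)) = x - y by abel,
      ← dist_eq_norm, ← dist_eq_norm] at this
  let _ : MeasurableSpace E := borel E
  have : BorelSpace E := ⟨rfl⟩
  obtain ⟨x, hx⟩ := (hlip.ae_differentiableAt (μ := MeasureTheory.Measure.addHaar)).exists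
  have hslope (v : E) : Tendsto (fun t : ℝ => t⁻¹ • (φ (x + t • v) - φ x)) (𝓝[≠] 0)
      (𝓝 (fderiv ℝ φ x v)) := by
    simpa using (hx.hasFDerivAt.hasLineDerivAt v).tendsto_slope_zero
  refine ⟨C, fderiv ℝ φ x, fun v => ?_, fun i u hu v => ?_⟩
  · refine (U i₀).closed_of_finiteDimensional.mem_of_tendsto ((hslope v).sub_const v) ?_
    filter_upwards [self_mem_nhdsWithin] with t ht
    have hmem := (U i₀).smul_mem t⁻¹ (sub_mem (hsection (x + t • v)) (hsection x))
    convert! hmem using 1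
    rw [show φ (x + t • v) - (x + t • v) - (φ x - x) = φ (x + t • v) - φ x - t • v by abel,
      inv_smul_sub_eq ht]
  · refine le_of_tendsto_of_tendsto (hslope v).norm
      (((hslope v).sub_const u).norm.const_mul C) ?_
    filter_upwards [self_mem_nhdsWithin] with t ht
    rw [inv_smul_sub_eq ht, norm_smul, norm_smul, mul_left_comm]
    gcongr
    exact hφ i _ ((U i).smul_mem t hu) _ _

theorem exists_isCompl_forall_disjoint (h : IsCoarseCommonComplement T U) (i₀ : ι) :
    ∃ W, IsCompl W (U i₀) ∧ ∀ i, Disjoint W (U i) := by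
  obtain ⟨C, L, hsection, hL⟩ := h.exists_linear_section i₀
  have hdisjoint (i : ι) : Disjoint L.range (U i) := by
    rw [Submodule.disjoint_def]
    rintro _ ⟨v, rfl⟩ hv
    exact norm_le_zero_iff.mp (by simpa using hL i _ hv v)
  refine ⟨L.range, ⟨hdisjoint i₀, codisjoint_iff_le_sup.mpr fun v _ => ?_⟩, hdisjoint⟩
  exact Submodule.mem_sup.mpr ⟨L v, ⟨v, rfl⟩, -(L v - v), neg_mem (hsection v), by abel⟩

theorem exists_forall_isCompl [Nonempty ι] (h : IsCoarseCommonComplement T U) :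
    ∃ W, ∀ i, IsCompl W (U i) := by
  have finrank_le (i j : ι) : finrank ℝ (U i) ≤ finrank ℝ (U j) := by
    obtain ⟨W, hW, hdisjoint⟩ := h.exists_isCompl_forall_disjoint j
    have := Submodule.finrank_add_eq_of_isCompl hW
    have := Submodule.finrank_add_finrank_le_of_disjoint (hdisjoint i)
    lia
  obtain ⟨i₀⟩ := ‹Nonempty ι›
  obtain ⟨W, hW, hdisjoint⟩ := h.exists_isCompl_forall_disjoint i₀
  refine ⟨W, fun i => (Submodule.isCompl_iff_disjoint _ _ ?_).mpr (hdisjoint i)⟩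
  rw [← Submodule.finrank_add_eq_of_isCompl hW]
  exact add_le_add_right (finrank_le i₀ i) _

end IsCoarseCommonComplement

theorem exists_discrete_addSubgroup_forall_norm_sub_le [FiniteDimensional ℝ E]
    (W : Submodule ℝ E) : ∃ Λ : AddSubgroup E, Λ ≤ W.toAddSubgroup ∧ DiscreteTopology Λ ∧
      ∃ R, ∀ w ∈ W, ∃ l ∈ Λ, ‖w - l‖ ≤ R := by
  let b := finBasis ℝ W
  let L : Submodule ℤ W := Submodule.span ℤ (Set.range b)
  let Λ : AddSubgroup E := L.toAddSubgroup.map W.subtype.toAddMonoidHom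
  have hΛW : Λ ≤ W.toAddSubgroup := by
    rintro _ ⟨w, -, rfl⟩
    exact w.2
  have hΛL (l : Λ) : (⟨l, hΛW l.2⟩ : W) ∈ L := by
    obtain ⟨_, w, hw, rfl⟩ := l
    exact hw
  have hcont : Continuous fun l : Λ => (⟨⟨l, hΛW l.2⟩, hΛL l⟩ : L) :=
    (continuous_subtype_val.subtype_mk _).subtype_mk _
  refine ⟨Λ, hΛW, DiscreteTopology.of_continuous_injective hcont fun l m hlm => ?_,
    ∑ i, ‖b i‖, fun w hw => ⟨ZSpan.floor b ⟨w, hw⟩, ⟨_, (ZSpan.floor b ⟨w, hw⟩).2, rfl⟩, ?_⟩⟩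
  · exact Subtype.ext (congrArg (fun x : L => ((x : W) : E)) hlm)
  · exact ZSpan.norm_fract_le b ⟨w, hw⟩

theorem exists_pos_forall_mul_norm_le_norm_sub [FiniteDimensional ℝ E] {X : Type*}
    [TopologicalSpace X] [CompactSpace X] {A : X → E →ₗ[ℝ] F}
    (hA : Continuous fun p : X × E => A p.1 p.2) {V : Submodule ℝ F} (hV : IsClosed (V : Set F))
    (hAV : ∀ x v, A x v ∈ V → v = 0) :
    ∃ c > 0, ∀ x v, ∀ y ∈ V, c * ‖v‖ ≤ ‖A x v - y‖ := by
  have hpos : ∀ p ∈ (Set.univ : Set X) ×ˢ Metric.sphere (0 : E) 1,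
      0 < Metric.infDist (A p.1 p.2) V := fun p hp =>
    (hV.notMem_iff_infDist_pos ⟨0, V.zero_mem⟩).mp fun hmem =>
      ne_zero_of_mem_unit_sphere ⟨p.2, hp.2⟩ (hAV _ _ hmem)
  obtain ⟨c, hc, hle⟩ := (isCompact_univ.prod (isCompact_sphere (0 : E) 1)).exists_forall_le'
    ((Metric.continuous_infDist_pt _).comp hA).continuousOn hpos
  refine ⟨c, hc, fun x v y hy => ?_⟩
  obtain rfl | hv := eq_or_ne v 0
  · simp
  have hunit : ‖v‖⁻¹ • v ∈ Metric.sphere (0 : E) 1 := by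
    rw [mem_sphere_zero_iff_norm, norm_smul, norm_inv, norm_norm,
      inv_mul_cancel₀ (norm_ne_zero_iff.mpr hv)]
  rw [← le_div_iff₀ (norm_pos_iff.mpr hv)]
  calc c ≤ Metric.infDist (A x (‖v‖⁻¹ • v)) V := hle (x, _) ⟨Set.mem_univ _, hunit⟩
    _ ≤ dist (A x (‖v‖⁻¹ • v)) (‖v‖⁻¹ • y) := Metric.infDist_le_dist_of_mem (V.smul_mem _ hy)
    _ = ‖A x v - y‖ / ‖v‖ := by
      rw [map_smul, dist_eq_norm, ← smul_sub, norm_smul, norm_inv, norm_norm, inv_mul_eq_div]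

end CoarseComplements

section CliffordKlein

open QuotientGroup

theorem exists_subset_image_setOf_le {X Y : Type*} [TopologicalSpace X] [TopologicalSpace Y]
    {π : X → Y} (hπ : IsOpenMap π) (hsurj : Function.Surjective π) {ν : X → ℝ}
    (hν : Continuous ν) {C : Set Y} (hC : IsCompact C) : ∃ r, C ⊆ π '' {x | ν x ≤ r} := by
  have hmono : Monotone fun r : ℝ => π '' {x | ν x < r} := fun r s hrs =>
    Set.image_mono fun x hx => lt_of_lt_of_le hx hrs
  have hcover : C ⊆ ⋃ r : ℝ, π '' {x | ν x < r} := fun y _ => by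
    obtain ⟨x, rfl⟩ := hsurj y
    exact Set.mem_iUnion.mpr ⟨ν x + 1, x, lt_add_one (ν x), rfl⟩
  obtain ⟨r, hr⟩ := hC.elim_directed_cover _
    (fun r => hπ _ (isOpen_lt hν continuous_const)) hcover hmono.directed_le
  exact ⟨r, hr.trans (Set.image_mono fun x (hx : ν x < r) => hx.le)⟩

variable {G : Type*} [Group G] {Γ H : Subgroup G}

theorem smul_coe_eq_coe_iff (γ : Γ) (u v : G) :
    γ • (u : G ⧸ H) = v ↔ v⁻¹ * γ * u ∈ H := by
  rw [eq_comm, mul_assoc]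
  exact QuotientGroup.eq

theorem free_quotient_iff : (∀ (γ : Γ) (x : G ⧸ H), γ • x = x → γ = 1) ↔
    ∀ γ ∈ Γ, ∀ g : G, g⁻¹ * γ * g ∈ H → γ = 1 := by
  constructor
  · intro h γ hγ g hg
    exact congrArg Subtype.val (h ⟨γ, hγ⟩ g ((smul_coe_eq_coe_iff _ _ _).mpr hg))
  · rintro h γ ⟨g⟩ hg
    exact Subtype.ext (h γ γ.2 g ((smul_coe_eq_coe_iff γ g g).mp hg))

variable [TopologicalSpace G] [ContinuousMul G] {ν : G → ℝ}

theorem properlyDiscontinuousSMul_quotient_iff (hν : Continuous ν)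
    (hproper : ∀ r, IsCompact {g | ν g ≤ r}) :
    ProperlyDiscontinuousSMul Γ (G ⧸ H) ↔
      ∀ r, {γ : Γ | ∃ u v : G, ν u ≤ r ∧ ν v ≤ r ∧ v⁻¹ * γ * u ∈ H}.Finite := by
  refine ⟨fun _ r => ?_, fun h => ⟨fun {C D} hC hD => ?_⟩⟩
  · have hcompact := (hproper r).image (continuous_mk (N := H))
    refine (ProperlyDiscontinuousSMul.finite_disjoint_inter_image (Γ := Γ) hcompact hcompact).subset
      fun γ ⟨u, v, hu, hv, huv⟩ =>
        ⟨v, ⟨u, ⟨u, hu, rfl⟩, (smul_coe_eq_coe_iff γ u v).mpr huv⟩, v, hv, rfl⟩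
  · obtain ⟨r, hr⟩ := exists_subset_image_setOf_le isOpenMap_coe mk_surjective hν (hC.union hD)
    refine (h r).subset ?_
    rintro γ ⟨_, ⟨x, hx, rfl⟩, hxD⟩
    obtain ⟨u, hu, rfl⟩ := hr (.inl hx)
    obtain ⟨v, hv, huv⟩ := hr (.inr hxD)
    exact ⟨u, v, hu, hv, (smul_coe_eq_coe_iff γ u v).mp huv.symm⟩

theorem compactSpace_doubleQuotient_iff (hν : Continuous ν)
    (hproper : ∀ r, IsCompact {g | ν g ≤ r}) :
    CompactSpace (Quotient (MulAction.orbitRel Γ (G ⧸ H))) ↔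
      ∃ r, ∀ g, ∃ γ ∈ Γ, ∃ u, ν u ≤ r ∧ ∃ h ∈ H, g = γ * u * h := by
  let π : G → Quotient (MulAction.orbitRel Γ (G ⧸ H)) := fun g => ⟦(g : G ⧸ H)⟧
  have : ContinuousConstSMul Γ (G ⧸ H) := ⟨fun γ => continuous_const_smul (γ : G)⟩
  have hopen : IsOpenMap π := isOpenMap_quotient_mk'_mul.comp isOpenMap_coe
  have hcont : Continuous π := continuous_quotient_mk'.comp continuous_mk
  have hsurj : Function.Surjective π := Quotient.mk_surjective.comp mk_surjective
  have heq (g u : G) : π u = π g ↔ ∃ γ ∈ Γ, ∃ h ∈ H, g = γ * u * h := by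
    rw [eq_comm, Quotient.eq]
    constructor
    · rintro ⟨γ, hγ⟩
      exact ⟨γ, γ.2, _, QuotientGroup.eq.mp hγ, (mul_inv_cancel_left _ _).symm⟩
    · rintro ⟨γ, hγ, h, hh, rfl⟩
      exact ⟨⟨γ, hγ⟩, QuotientGroup.eq.mpr (by simpa [mul_assoc] using hh)⟩
  constructor
  · intro _
    obtain ⟨r, hr⟩ := exists_subset_image_setOf_le hopen hsurj hν isCompact_univ
    refine ⟨r, fun g => ?_⟩
    obtain ⟨u, hu, hug⟩ := hr (Set.mem_univ (π g))
    obtain ⟨γ, hγ, h, hh, rfl⟩ := (heq g u).mp hug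
    exact ⟨γ, hγ, u, hu, h, hh, rfl⟩
  · rintro ⟨r, hr⟩
    refine ⟨((hproper r).image hcont).of_isClosed_subset isClosed_univ fun x _ => ?_⟩
    obtain ⟨g, rfl⟩ := hsurj x
    obtain ⟨γ, hγ, u, hu, h, hh, rfl⟩ := hr g
    exact ⟨u, hu, (heq _ u).mpr ⟨γ, hγ, h, hh, rfl⟩⟩

end CliffordKlein

section MotionGroup

open Matrix

variable {n : Type*} [Fintype n] [DecidableEq n] {G H : Subgroup (GL n ℝ)}

theorem coe_mem_unitary (k : fixedSubgroup G) :
    ((k : GL n ℝ) : Matrix n n ℝ) ∈ unitary (Matrix n n ℝ) := by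
  have hk : star ((k : GL n ℝ) : Matrix n n ℝ) = ((k : GL n ℝ)⁻¹ : GL n ℝ) := k.2.2
  exact Unitary.mem_iff.mpr ⟨by simp [hk], by simp [hk]⟩

open scoped Matrix.Norms.L2Operator

theorem norm_Ad (k : fixedSubgroup G) (X : symmetricPart G) : ‖Ad G k X‖ = ‖X‖ := by
  have hinv : (((k⁻¹ : fixedSubgroup G) : GL n ℝ) : Matrix n n ℝ) ∈ unitary (Matrix n n ℝ) :=
    coe_mem_unitary k⁻¹
  exact (CStarRing.norm_mul_mem_unitary _ hinv).trans
    (CStarRing.norm_mem_unitary_mul _ (coe_mem_unitary k))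

theorem continuous_Ad_apply {X : Type*} [TopologicalSpace X] {k : X → fixedSubgroup G}
    {Y : X → symmetricPart G} (hk : Continuous k) (hY : Continuous Y) :
    Continuous fun x => Ad G (k x) (Y x) := by
  have hk' : Continuous fun x => (k x : GL n ℝ) := continuous_subtype_val.comp hk
  have hconj : Continuous fun x =>
      ((k x : GL n ℝ) : Matrix n n ℝ) * Y x * ((k x : GL n ℝ)⁻¹ : GL n ℝ) :=
    ((Units.continuous_val.comp hk').mul (continuous_subtype_val.comp hY)).mul
      (Units.continuous_val.comp hk'.inv)
  exact hconj.subtype_mk _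

theorem isCompact_unitary : IsCompact (unitary (Matrix n n ℝ) : Set (Matrix n n ℝ)) := by
  refine IsCompact.of_isClosed_subset
    (isCompact_univ_pi fun _ => isCompact_univ_pi fun _ => isCompact_closedBall (0 : ℝ) 1)
    isClosed_unitary fun U hU i _ j _ => ?_
  exact mem_closedBall_zero_iff.mpr (entry_norm_bound_of_unitary hU i j)

theorem compactSpace_fixedSubgroup (hG : IsClosed (G : Set (GL n ℝ))) :
    CompactSpace (fixedSubgroup G) := by
  have hcompact : CompactSpace (unitary (Matrix n n ℝ)) :=
    isCompact_iff_compactSpace.mp isCompact_unitary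
  have hcont : Continuous (Unitary.toUnits : unitary (Matrix n n ℝ) →* GL n ℝ) :=
    Units.continuous_iff.mpr ⟨continuous_subtype_val, continuous_subtype_val.comp continuous_inv⟩
  have hfixed : (fixedSubgroup G : Set (GL n ℝ)) =
      Set.range (Unitary.toUnits : unitary (Matrix n n ℝ) →* GL n ℝ) ∩ G := by
    ext k
    constructor
    · exact fun hk => ⟨⟨⟨k, coe_mem_unitary ⟨k, hk⟩⟩, Units.ext rfl⟩, hk.1⟩
    · rintro ⟨⟨U, rfl⟩, hU⟩
      exact ⟨hU, rfl⟩
  have : IsCompact (fixedSubgroup G : Set (GL n ℝ)) :=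
    hfixed ▸ (isCompact_range hcont).inter_right hG
  exact isCompact_iff_compactSpace.mp this

namespace CartanMotionGroup

/-- The component of `x : CartanMotionGroup G` in `𝔭`. -/
def translation (x : CartanMotionGroup G) : symmetricPart G := x.left.toAdd

/-- The component of `x : CartanMotionGroup G` in `K`. -/
def linearPart (x : CartanMotionGroup G) : fixedSubgroup G := x.right

/-- The element of the Cartan motion group with components `X ∈ 𝔭` and `k ∈ K`. -/
def mk (X : symmetricPart G) (k : fixedSubgroup G) : CartanMotionGroup G := ⟨.ofAdd X, k⟩

@[simp] theorem translation_mk (X : symmetricPart G) (k : fixedSubgroup G) :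
    translation (mk X k) = X := rfl

@[simp] theorem linearPart_mk (X : symmetricPart G) (k : fixedSubgroup G) :
    linearPart (mk X k) = k := rfl

@[simp] theorem translation_mul (x y : CartanMotionGroup G) :
    translation (x * y) = translation x + Ad G (linearPart x) (translation y) := rfl

@[simp] theorem linearPart_mul (x y : CartanMotionGroup G) :
    linearPart (x * y) = linearPart x * linearPart y := rfl

@[simp] theorem translation_inv (x : CartanMotionGroup G) :
    translation x⁻¹ = Ad G (linearPart x)⁻¹ (-translation x) := rfl

@[simp] theorem linearPart_inv (x : CartanMotionGroup G) : linearPart x⁻¹ = (linearPart x)⁻¹ := rfl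

theorem ext {x y : CartanMotionGroup G} (ht : translation x = translation y)
    (hr : linearPart x = linearPart y) : x = y :=
  SemidirectProduct.ext ht hr

/-- The Cartan motion group is, as a topological space, `𝔭 × K`. -/
def homeomorphProd : CartanMotionGroup G ≃ₜ symmetricPart G × fixedSubgroup G :=
  Equiv.toHomeomorphOfIsInducing
    { toFun := fun x => (translation x, linearPart x)
      invFun := fun p => mk p.1 p.2
      left_inv := fun _ => rfl
      right_inv := fun _ => rfl } ⟨rfl⟩

theorem continuous_translation : Continuous (translation (G := G)) :=
  continuous_fst.comp homeomorphProd.continuous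

theorem continuous_linearPart : Continuous (linearPart (G := G)) :=
  continuous_snd.comp homeomorphProd.continuous

instance : ContinuousMul (CartanMotionGroup G) where
  continuous_mul := by
    have hlinear := continuous_linearPart (G := G)
    have htranslation := continuous_translation (G := G)
    have hAd : Continuous fun p : CartanMotionGroup G × CartanMotionGroup G =>
        Ad G (linearPart p.1) (translation p.2) :=
      continuous_Ad_apply (hlinear.comp continuous_fst) (htranslation.comp continuous_snd)
    exact homeomorphProd.comp_continuous_iff.mp <|
      ((htranslation.comp continuous_fst).add hAd).prodMk <|
        (hlinear.comp continuous_fst).mul (hlinear.comp continuous_snd)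

theorem continuous_norm_translation : Continuous fun x : CartanMotionGroup G => ‖translation x‖ :=
  continuous_translation.norm

theorem isCompact_setOf_norm_translation_le [CompactSpace (fixedSubgroup G)] (r : ℝ) :
    IsCompact {x : CartanMotionGroup G | ‖translation x‖ ≤ r} := by
  have hcompact := (isCompact_closedBall (0 : symmetricPart G) r).prod
    (isCompact_univ (X := fixedSubgroup G))
  rw [← homeomorphProd.isCompact_preimage] at hcompact
  refine hcompact.of_isClosed_subset (isClosed_le continuous_norm_translation continuous_const) ?_
  exact fun x hx => ⟨mem_closedBall_zero_iff.mpr hx, Set.mem_univ _⟩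

end CartanMotionGroup

end MotionGroup

section CompactForms

open Matrix CartanMotionGroup
open scoped Matrix.Norms.L2Operator

variable {n : Type*} [Fintype n] [DecidableEq n] {G H : Subgroup (GL n ℝ)}

/-- The subspace `𝔭 ∩ 𝔥` of `𝔭`, for which `tangentialSubgroup G H` is `(K ∩ H) ⋉ (𝔭 ∩ 𝔥)`. -/
def tangentialSubmodule (G H : Subgroup (GL n ℝ)) : Submodule ℝ (symmetricPart G) :=
  (lieAlgebra H).comap (symmetricPart G).subtype

theorem mem_tangentialSubgroup {x : CartanMotionGroup G} :
    x ∈ tangentialSubgroup G H ↔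
      (linearPart x : GL n ℝ) ∈ H ∧ translation x ∈ tangentialSubmodule G H :=
  Iff.rfl

theorem Ad_mem_tangentialSubmodule {k : fixedSubgroup G} (hk : (k : GL n ℝ) ∈ H)
    {X : symmetricPart G} (hX : X ∈ tangentialSubmodule G H) :
    Ad G k X ∈ tangentialSubmodule G H :=
  conj_mem_lieAlgebra hk hX

theorem Ad_Ad_inv (k : fixedSubgroup G) (X : symmetricPart G) : Ad G k (Ad G k⁻¹ X) = X := by
  rw [← Ad_mul, mul_inv_cancel, Ad_one]

theorem mem_map_Ad_iff {S : Submodule ℝ (symmetricPart G)} {k : fixedSubgroup G}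
    {X : symmetricPart G} : X ∈ S.map (Ad G k) ↔ Ad G k⁻¹ X ∈ S := by
  refine ⟨?_, fun hX => ⟨_, hX, Ad_Ad_inv k X⟩⟩
  rintro ⟨Y, hY, rfl⟩
  rwa [← Ad_mul, inv_mul_cancel, Ad_one]

theorem norm_translation_inv_mul (x y : CartanMotionGroup G) :
    ‖translation (x⁻¹ * y)‖ = ‖translation y - translation x‖ := by
  rw [← norm_Ad (linearPart x)⁻¹ (translation y - translation x), translation_mul, translation_inv,
    linearPart_inv, map_neg, map_sub, neg_add_eq_sub]

section CoarseComplement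

variable [CompactSpace (fixedSubgroup G)] {Γ : Subgroup (CartanMotionGroup G)}

theorem exists_forall_norm_sub_sub_le
    (hΓ : CompactSpace
      (Quotient (MulAction.orbitRel Γ (CartanMotionGroup G ⧸ tangentialSubgroup G H)))) :
    ∃ R, ∀ (k : fixedSubgroup G) (X : symmetricPart G), ∃ t ∈ translation '' (Γ : Set _),
      ∃ Y ∈ (tangentialSubmodule G H).map (Ad G k), ‖X - t - Y‖ ≤ R := by
  obtain ⟨r, hr⟩ := (compactSpace_doubleQuotient_iff continuous_norm_translation
    isCompact_setOf_norm_translation_le).mp hΓ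
  refine ⟨r, fun k X => ?_⟩
  obtain ⟨γ, hγ, u, hu, h, hh, hg⟩ := hr (mk X k)
  have hlinear : linearPart γ * linearPart u = k * (linearPart h)⁻¹ :=
    eq_mul_inv_of_mul_eq (congrArg linearPart hg).symm
  have htranslation : X = translation γ + Ad G (linearPart γ) (translation u) +
      Ad G k (Ad G (linearPart h)⁻¹ (translation h)) := by
    rw [← Ad_mul, ← hlinear]
    exact congrArg translation hg
  have hmem : Ad G (linearPart h)⁻¹ (translation h) ∈ tangentialSubmodule G H :=
    Ad_mem_tangentialSubmodule (H.inv_mem hh.1) hh.2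
  refine ⟨_, ⟨γ, hγ, rfl⟩, _, ⟨_, hmem, rfl⟩, ?_⟩
  calc ‖X - translation γ - Ad G k (Ad G (linearPart h)⁻¹ (translation h))‖
      = ‖Ad G (linearPart γ) (translation u)‖ := by rw [htranslation]; congr 1; abel
    _ ≤ r := (norm_Ad _ _).trans_le hu

theorem exists_forall_norm_sub_le
    (hΓ : ProperlyDiscontinuousSMul Γ (CartanMotionGroup G ⧸ tangentialSubgroup G H)) (r : ℝ) :
    ∃ D, ∀ k : fixedSubgroup G, ∀ t ∈ translation '' (Γ : Set _),
      ∀ t' ∈ translation '' (Γ : Set _), ∀ Y ∈ (tangentialSubmodule G H).map (Ad G k),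
      ‖t - t' - Y‖ ≤ r → ‖t - t'‖ ≤ D := by
  have hfinite := (properlyDiscontinuousSMul_quotient_iff continuous_norm_translation
    isCompact_setOf_norm_translation_le).mp hΓ r
  obtain ⟨D, hD⟩ := (hfinite.image fun γ : Γ => ‖translation (γ : CartanMotionGroup G)‖).bddAbove
  refine ⟨D, ?_⟩
  rintro k _ ⟨γ, hγ, rfl⟩ _ ⟨γ', hγ', rfl⟩ _ ⟨Y, hY, rfl⟩ hle
  let Z := translation γ - translation γ' - Ad G k Y
  let u : CartanMotionGroup G := mk 0 ((linearPart γ)⁻¹ * k)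
  let v : CartanMotionGroup G := mk (Ad G (linearPart γ')⁻¹ Z) ((linearPart γ')⁻¹ * k)
  have hmul : γ * u = γ' * v * mk Y 1 := by
    refine CartanMotionGroup.ext ?_ (by simp [u, v])
    simp only [u, v, translation_mul, linearPart_mul, translation_mk, linearPart_mk, Ad_Ad_inv,
      mul_inv_cancel_left, map_zero, Z]
    abel
  have hmem : v⁻¹ * (γ'⁻¹ * γ) * u ∈ tangentialSubgroup G H := by
    rw [mul_assoc, mul_assoc, hmul, mul_assoc, inv_mul_cancel_left, inv_mul_cancel_left]
    exact ⟨H.one_mem, hY⟩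
  have hu : ‖translation u‖ ≤ r := by simpa [u] using (norm_nonneg _).trans hle
  have hv : ‖translation v‖ ≤ r := (norm_Ad _ _).trans_le hle
  rw [← norm_translation_inv_mul]
  exact hD ⟨⟨_, Γ.mul_mem (Γ.inv_mem hγ') hγ⟩, ⟨u, v, hu, hv, hmem⟩, rfl⟩

theorem isCoarseCommonComplement_translation_image
    (hΓ : IsDiscontinuousGroup Γ (tangentialSubgroup G H))
    (hcompact : CompactSpace
      (Quotient (MulAction.orbitRel Γ (CartanMotionGroup G ⧸ tangentialSubgroup G H)))) :
    IsCoarseCommonComplement (translation '' (Γ : Set (CartanMotionGroup G)))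
      fun k => (tangentialSubmodule G H).map (Ad G k) where
  exists_norm_sub_sub_le := exists_forall_norm_sub_sub_le hcompact
  exists_norm_sub_le := exists_forall_norm_sub_le hΓ.properlyDiscontinuous

end CoarseComplement

section Lattice

/-- The group of the pure translations of the Cartan motion group by the elements of `Λ ≤ 𝔭`. -/
def translationSubgroup (Λ : AddSubgroup (symmetricPart G)) : Subgroup (CartanMotionGroup G) where
  carrier := {x | linearPart x = 1 ∧ translation x ∈ Λ}
  one_mem' := ⟨rfl, Λ.zero_mem⟩
  mul_mem' := by
    rintro x y ⟨hx, hx'⟩ ⟨hy, hy'⟩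
    refine ⟨by rw [linearPart_mul, hx, hy, one_mul], ?_⟩
    rw [translation_mul, hx, Ad_one]
    exact Λ.add_mem hx' hy'
  inv_mem' := by
    rintro x ⟨hx, hx'⟩
    refine ⟨by rw [linearPart_inv, hx, inv_one], ?_⟩
    rw [translation_inv, hx, inv_one, Ad_one]
    exact Λ.neg_mem hx'

variable {Λ : AddSubgroup (symmetricPart G)}

theorem translation_injOn_translationSubgroup :
    Set.InjOn translation (translationSubgroup Λ : Set (CartanMotionGroup G)) :=
  fun _ hx _ hy hxy => CartanMotionGroup.ext hxy (hx.1.trans hy.1.symm)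

theorem exists_translation_sub_eq {γ u v : CartanMotionGroup G} (hγ : γ ∈ translationSubgroup Λ)
    (h : v⁻¹ * γ * u ∈ tangentialSubgroup G H) :
    ∃ Y ∈ (tangentialSubmodule G H).map (Ad G (linearPart v)),
      translation γ - Y = translation v - translation u := by
  refine ⟨_, ⟨_, (mem_tangentialSubgroup.mp h).2, rfl⟩, ?_⟩
  have hmul : γ * u = v * (v⁻¹ * γ * u) := by group
  have htranslation := congrArg translation hmul
  rw [translation_mul, translation_mul, hγ.1, Ad_one] at htranslation
  change translation γ - Ad G (linearPart v) (translation (v⁻¹ * γ * u)) = _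
  rw [sub_eq_sub_iff_add_eq_add, htranslation]

instance [DiscreteTopology Λ] : DiscreteTopology (translationSubgroup Λ) := by
  have hcont : Continuous fun γ : translationSubgroup Λ => (⟨translation γ.1, γ.2.2⟩ : Λ) :=
    (continuous_translation.comp continuous_subtype_val).subtype_mk _
  exact DiscreteTopology.of_continuous_injective hcont fun γ δ h => Subtype.ext
    (translation_injOn_translationSubgroup γ.2 δ.2 (congrArg Subtype.val h))

variable [CompactSpace (fixedSubgroup G)]

theorem exists_pos_forall_mul_norm_le {W : Submodule ℝ (symmetricPart G)}
    (hW : ∀ k, Disjoint W ((tangentialSubmodule G H).map (Ad G k))) :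
    ∃ c > 0, ∀ k, ∀ w ∈ W, ∀ Y ∈ (tangentialSubmodule G H).map (Ad G k),
      c * ‖w‖ ≤ ‖w - Y‖ := by
  let A (k : fixedSubgroup G) : W →ₗ[ℝ] symmetricPart G := Ad G k⁻¹ ∘ₗ W.subtype
  have hA : Continuous fun p : fixedSubgroup G × W => A p.1 p.2 := by
    have hW : Continuous fun p : fixedSubgroup G × W => (p.2 : symmetricPart G) := by fun_prop
    simp only [A, LinearMap.comp_apply, Submodule.subtype_apply]
    exact continuous_Ad_apply continuous_fst.inv hW
  have hAV (k : fixedSubgroup G) (w : W) (hw : A k w ∈ tangentialSubmodule G H) : w = 0 :=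
    Subtype.ext (Submodule.disjoint_def.mp (hW k) w w.2 ⟨_, hw, Ad_Ad_inv k _⟩)
  obtain ⟨c, hc, hle⟩ := exists_pos_forall_mul_norm_le_norm_sub (E := W)
    (V := tangentialSubmodule G H) hA (Submodule.closed_of_finiteDimensional _) hAV
  refine ⟨c, hc, ?_⟩
  rintro k w hw _ ⟨Y, hY, rfl⟩
  calc c * ‖w‖ ≤ ‖Ad G k⁻¹ w - Y‖ := hle k ⟨w, hw⟩ Y hY
    _ = ‖w - Ad G k Y‖ := by rw [← norm_Ad k, map_sub, Ad_Ad_inv]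

theorem isDiscontinuousGroup_translationSubgroup {W : Submodule ℝ (symmetricPart G)}
    (hW : ∀ k, Disjoint W ((tangentialSubmodule G H).map (Ad G k)))
    (hΛ : Λ ≤ W.toAddSubgroup) [DiscreteTopology Λ] :
    IsDiscontinuousGroup (translationSubgroup Λ) (tangentialSubgroup G H) := by
  obtain ⟨c, hc, hle⟩ := exists_pos_forall_mul_norm_le hW
  have hbound {γ u v : CartanMotionGroup G} (hγ : γ ∈ translationSubgroup Λ)
      (h : v⁻¹ * γ * u ∈ tangentialSubgroup G H) :
      c * ‖translation γ‖ ≤ ‖translation v - translation u‖ := by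
    obtain ⟨Y, hY, hγY⟩ := exists_translation_sub_eq hγ h
    exact hγY ▸ hle _ _ (hΛ hγ.2) Y hY
  refine ⟨inferInstance, ?_, free_quotient_iff.mpr fun γ hγ g hg => ?_⟩
  · rw [properlyDiscontinuousSMul_quotient_iff continuous_norm_translation
      isCompact_setOf_norm_translation_le]
    intro r
    have hfinite : ((Λ : Set (symmetricPart G)) ∩ Metric.closedBall 0 (2 * r / c)).Finite := by
      rw [Set.inter_comm]
      exact Metric.finite_isBounded_inter_isClosed DiscreteTopology.isDiscrete
        Metric.isBounded_closedBall AddSubgroup.isClosed_of_discrete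
    refine Set.Finite.of_finite_image (f := fun γ => translation γ.1) (hfinite.subset ?_)
      fun γ _ δ _ h => Subtype.ext (translation_injOn_translationSubgroup γ.2 δ.2 h)
    rintro _ ⟨γ, ⟨u, v, hu, hv, huv⟩, rfl⟩
    refine ⟨γ.2.2, mem_closedBall_zero_iff.mpr ((le_div_iff₀' hc).mpr ?_)⟩
    linarith [hbound γ.2 huv, norm_sub_le (translation v) (translation u)]
  · have : ‖translation γ‖ ≤ 0 := by
      have := hbound hγ hg
      rw [sub_self, norm_zero] at this
      exact nonpos_of_mul_nonpos_right this hc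
    exact CartanMotionGroup.ext (norm_le_zero_iff.mp this) hγ.1

theorem compactSpace_doubleQuotient_translationSubgroup {W : Submodule ℝ (symmetricPart G)}
    (hW : ∀ k, Codisjoint W ((tangentialSubmodule G H).map (Ad G k)))
    {R : ℝ} (hΛ : ∀ w ∈ W, ∃ l ∈ Λ, ‖w - l‖ ≤ R) :
    CompactSpace (Quotient (MulAction.orbitRel (translationSubgroup Λ)
      (CartanMotionGroup G ⧸ tangentialSubgroup G H))) := by
  refine (compactSpace_doubleQuotient_iff continuous_norm_translation
    isCompact_setOf_norm_translation_le).mpr ⟨R, fun g => ?_⟩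
  obtain ⟨w, hw, _, ⟨Y, hY, rfl⟩, hwY⟩ :=
    Submodule.mem_sup.mp ((hW (linearPart g)).eq_top ▸ Submodule.mem_top (x := translation g))
  obtain ⟨l, hl, hle⟩ := hΛ w hw
  refine ⟨mk l 1, ⟨rfl, hl⟩, mk (w - l) (linearPart g), hle, mk Y 1, ⟨H.one_mem, hY⟩,
    CartanMotionGroup.ext ?_ (by simp)⟩
  simp [Ad_one, hwY]

end Lattice

theorem admitsCompactCliffordKleinForm_tangentialSubgroup_iff [CompactSpace (fixedSubgroup G)] :
    AdmitsCompactCliffordKleinForm (tangentialSubgroup G H) ↔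
      ∃ W : Submodule ℝ (symmetricPart G),
        ∀ k, IsCompl W ((tangentialSubmodule G H).map (Ad G k)) := by
  constructor
  · rintro ⟨Γ, hΓ, hcompact⟩
    exact (isCoarseCommonComplement_translation_image hΓ hcompact).exists_forall_isCompl
  · rintro ⟨W, hW⟩
    obtain ⟨Λ, hΛW, hdiscrete, R, hR⟩ := exists_discrete_addSubgroup_forall_norm_sub_le W
    exact ⟨translationSubgroup Λ,
      isDiscontinuousGroup_translationSubgroup (fun k => (hW k).disjoint) hΛW,
      compactSpace_doubleQuotient_translationSubgroup (fun k => (hW k).codisjoint) hR⟩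

end CompactForms

section NonsingularBilinearMaps

open Module

theorem exists_linearMap_apply_eq {K V F : Type*} [Field K] [AddCommGroup V] [Module K V]
    [AddCommGroup F] [Module K F] {v : V} (hv : v ≠ 0) (w : F) : ∃ φ : V →ₗ[K] F, φ v = w := by
  obtain ⟨ℓ, hℓ⟩ := Projective.exists_dual_eq_one K hv
  exact ⟨ℓ.smulRight w, by simp [hℓ]⟩

theorem exists_isCompl_ker_applyₗ_iff {K V F : Type*} [Field K] [AddCommGroup V] [Module K V]
    [AddCommGroup F] [Module K F] [FiniteDimensional K F] :
    (∃ W : Submodule K (V →ₗ[K] F), ∀ v ≠ 0,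
      IsCompl W (LinearMap.ker (LinearMap.applyₗ v : (V →ₗ[K] F) →ₗ[K] F))) ↔
      ∃ f : V →ₗ[K] F →ₗ[K] F, ∀ v w, f v w = 0 → v = 0 ∨ w = 0 := by
  constructor
  · rintro ⟨W, hW⟩
    rcases subsingleton_or_nontrivial V with _ | _
    · exact ⟨0, fun v _ _ => .inl (Subsingleton.elim v 0)⟩
    obtain ⟨v₀, hv₀⟩ := exists_ne (0 : V)
    have hrange : LinearMap.range (LinearMap.applyₗ v₀ : (V →ₗ[K] F) →ₗ[K] F) = ⊤ :=
      LinearMap.range_eq_top.mpr fun w => exists_linearMap_apply_eq hv₀ w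
    let e : W ≃ₗ[K] F := (LinearMap.kerComplementEquivRange _ (hW v₀ hv₀)).trans
      (LinearEquiv.ofTop _ hrange)
    refine ⟨(W.subtype ∘ₗ e.symm.toLinearMap).flip, fun v w hvw => or_iff_not_imp_left.mpr ?_⟩
    intro hv
    have hzero := Submodule.disjoint_def.mp (hW v hv).disjoint _ (e.symm w).2 hvw
    simpa using hzero
  · rintro ⟨f, hf⟩
    refine ⟨LinearMap.range f.flip, fun v hv => ?_⟩
    have hinj : Function.Injective (f v) :=
      (injective_iff_map_eq_zero _).mpr fun w hw => (hf v w hw).resolve_left hv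
    have hsurj : Function.Surjective (f v) := LinearMap.surjective_of_injective hinj
    rw [isCompl_iff, Submodule.disjoint_def, codisjoint_iff, Submodule.eq_top_iff']
    constructor
    · rintro _ ⟨w, rfl⟩ hw
      simp [(hf v w hw).resolve_left hv]
    · intro φ
      obtain ⟨w, hw⟩ := hsurj (φ v)
      exact Submodule.mem_sup.mpr ⟨_, ⟨w, rfl⟩, φ - f.flip w, by simp [hw], add_sub_cancel _ _⟩

end NonsingularBilinearMaps

section OneParameterSubgroups

open Matrix NormedSpace
open scoped Matrix.Norms.L2Operator

variable {n : Type*} [Fintype n] [DecidableEq n]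

theorem hasDerivAt_transpose_exp_mul_mul_exp (J X : Matrix n n ℝ) (t : ℝ) :
    HasDerivAt (fun t : ℝ => (exp (t • X))ᵀ * J * exp (t • X))
      ((exp (t • X))ᵀ * (Xᵀ * J + J * X) * exp (t • X)) t := by
  have htranspose := (hasDerivAt_exp_smul_const (𝕂 := ℝ) Xᵀ t).mul_const J
  have hderiv := htranspose.mul (hasDerivAt_exp_smul_const' (𝕂 := ℝ) X t)
  simp only [← transpose_smul, Matrix.exp_transpose] at hderiv
  convert! hderiv using 1
  simp only [mul_add, add_mul, mul_assoc]

theorem forall_transpose_exp_mul_mul_exp_eq_iff {J X : Matrix n n ℝ} :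
    (∀ t : ℝ, (exp (t • X))ᵀ * J * exp (t • X) = J) ↔ Xᵀ * J + J * X = 0 := by
  have hderiv := hasDerivAt_transpose_exp_mul_mul_exp J X
  constructor
  · intro h
    simpa using (hderiv 0).unique ((hasDerivAt_const 0 J).congr_of_eventuallyEq (.of_forall h))
  · intro h t
    simp only [h, mul_zero, zero_mul] at hderiv
    simpa using is_const_of_deriv_eq_zero (fun s => (hderiv s).differentiableAt)
      (fun s => (hderiv s).deriv) t 0

theorem hasDerivAt_exp_mulVec (X : Matrix n n ℝ) (v : n → ℝ) (t : ℝ) :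
    HasDerivAt (fun t : ℝ => exp (t • X) *ᵥ v) (exp (t • X) *ᵥ X *ᵥ v) t := by
  rw [mulVec_mulVec]
  exact (LinearMap.toContinuousLinearMap ((mulVecBilin ℝ ℝ).flip v)).hasFDerivAt.comp_hasDerivAt t
    (hasDerivAt_exp_smul_const (𝕂 := ℝ) X t)

theorem forall_exp_mulVec_eq_iff {X : Matrix n n ℝ} {v : n → ℝ} :
    (∀ t : ℝ, exp (t • X) *ᵥ v = v) ↔ X *ᵥ v = 0 := by
  have hderiv := hasDerivAt_exp_mulVec X v
  constructor
  · intro h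
    simpa using (hderiv 0).unique ((hasDerivAt_const 0 v).congr_of_eventuallyEq (.of_forall h))
  · intro h t
    simp only [h, mulVec_zero] at hderiv
    simpa using is_const_of_deriv_eq_zero (fun s => (hderiv s).differentiableAt)
      (fun s => (hderiv s).deriv) t 0

theorem exists_coe_eq_exp_iff {P : Matrix n n ℝ → Prop} {X : Matrix n n ℝ} :
    (∃ g : GL n ℝ, P g ∧ (g : Matrix n n ℝ) = exp X) ↔ P (exp X) :=
  ⟨fun ⟨_, hg, hX⟩ => hX ▸ hg, fun h => ⟨(isUnit_exp X).unit, h, rfl⟩⟩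

theorem lieAlgebra_eq_of_forall_exp {G : Subgroup (GL n ℝ)} {P : Matrix n n ℝ → Prop}
    (hG : ∀ g : GL n ℝ, g ∈ G ↔ P g) {S : Submodule ℝ (Matrix n n ℝ)}
    (hS : ∀ X, X ∈ S ↔ ∀ t : ℝ, P (exp (t • X))) : lieAlgebra G = S := by
  rw [lieAlgebra, ← Submodule.span_eq S]
  congr 1
  ext X
  simp only [Set.mem_ofPred_eq, SetLike.mem_coe, hS, hG, exists_coe_eq_exp_iff]

end OneParameterSubgroups

section IndefiniteOrthogonal

open Matrix LieAlgebra.Orthogonal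

variable {p q : ℕ}

theorem indefiniteForm_eq_dotProduct (x : Fin p ⊕ Fin q → ℝ) :
    indefiniteForm p q x = x ⬝ᵥ indefiniteDiagonal (Fin p) (Fin q) ℝ *ᵥ x := by
  simp [indefiniteForm, indefiniteDiagonal, mulVec_diagonal, dotProduct, sq, sub_eq_add_neg]

theorem indefiniteDiagonal_eq_fromBlocks :
    indefiniteDiagonal (Fin p) (Fin q) ℝ = fromBlocks 1 0 0 (-1) := by
  rw [indefiniteDiagonal, ← diagonal_one, ← diagonal_one, diagonal_neg, fromBlocks_diagonal]

theorem isSymm_ext_of_dotProduct_mulVec {n R : Type*} [Fintype n] [Field R] [NeZero (2 : R)]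
    {A B : Matrix n n R} (hA : A.IsSymm) (hB : B.IsSymm)
    (h : ∀ x, x ⬝ᵥ A *ᵥ x = x ⬝ᵥ B *ᵥ x) : A = B := by
  classical
  refine toBilin'.injective (LinearMap.BilinForm.ext_of_isSymm
    (isSymm_toBilin'_iff_isSymm.mpr hA) (isSymm_toBilin'_iff_isSymm.mpr hB) fun x => ?_)
  simpa only [toBilin'_apply'] using h x

theorem mem_indefiniteOrthogonal_iff {g : GL (Fin p ⊕ Fin q) ℝ} :
    g ∈ indefiniteOrthogonal p q ↔
      (g : Matrix (Fin p ⊕ Fin q) (Fin p ⊕ Fin q) ℝ)ᵀ * indefiniteDiagonal (Fin p) (Fin q) ℝ * g =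
        indefiniteDiagonal (Fin p) (Fin q) ℝ := by
  have hJ : (indefiniteDiagonal (Fin p) (Fin q) ℝ).IsSymm := isSymm_diagonal _
  have hform (x : Fin p ⊕ Fin q → ℝ) : indefiniteForm p q (g.val *ᵥ x) =
      x ⬝ᵥ (g.valᵀ * indefiniteDiagonal (Fin p) (Fin q) ℝ * g.val) *ᵥ x := by
    rw [indefiniteForm_eq_dotProduct, ← mulVec_mulVec, ← mulVec_mulVec, dotProduct_mulVec x,
      vecMul_transpose]
  constructor
  · intro hg
    refine isSymm_ext_of_dotProduct_mulVec (by simp [IsSymm, hJ.eq, mul_assoc]) hJ fun x => ?_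
    rw [← hform, ← indefiniteForm_eq_dotProduct, hg x]
  · intro hg x
    rw [hform, hg, indefiniteForm_eq_dotProduct]

theorem isClosed_indefiniteOrthogonal :
    IsClosed (indefiniteOrthogonal p q : Set (GL (Fin p ⊕ Fin q) ℝ)) := by
  have hclosed : IsClosed {g : GL (Fin p ⊕ Fin q) ℝ |
      g.valᵀ * indefiniteDiagonal (Fin p) (Fin q) ℝ * g.val =
        indefiniteDiagonal (Fin p) (Fin q) ℝ} :=
    isClosed_eq (by fun_prop) continuous_const
  convert hclosed using 1
  ext g
  exact mem_indefiniteOrthogonal_iff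

theorem mem_skewAdjointMatricesSubmodule_iff_add_eq_zero {n R : Type*} [Fintype n] [DecidableEq n]
    [CommRing R] {J X : Matrix n n R} :
    X ∈ skewAdjointMatricesSubmodule J ↔ Xᵀ * J + J * X = 0 := by
  rw [mem_skewAdjointMatricesSubmodule, Matrix.IsSkewAdjoint, Matrix.IsAdjointPair, mul_neg,
    eq_neg_iff_add_eq_zero]

theorem lieAlgebra_indefiniteOrthogonal :
    lieAlgebra (indefiniteOrthogonal p q) =
      skewAdjointMatricesSubmodule (indefiniteDiagonal (Fin p) (Fin q) ℝ) :=
  lieAlgebra_eq_of_forall_exp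
    (P := fun A => Aᵀ * indefiniteDiagonal (Fin p) (Fin q) ℝ * A =
      indefiniteDiagonal (Fin p) (Fin q) ℝ)
    (fun _ => mem_indefiniteOrthogonal_iff) fun _ =>
      mem_skewAdjointMatricesSubmodule_iff_add_eq_zero.trans
        forall_transpose_exp_mul_mul_exp_eq_iff.symm

theorem lieAlgebra_indefiniteOrthogonalStabilizer :
    lieAlgebra (indefiniteOrthogonalStabilizer p q) =
      skewAdjointMatricesSubmodule (indefiniteDiagonal (Fin (p + 1)) (Fin q) ℝ) ⊓
        LinearMap.ker ((mulVecBilin ℝ ℝ).flip (Pi.single (Sum.inl 0) 1)) := by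
  refine lieAlgebra_eq_of_forall_exp
    (P := fun A => Aᵀ * indefiniteDiagonal (Fin (p + 1)) (Fin q) ℝ * A =
      indefiniteDiagonal (Fin (p + 1)) (Fin q) ℝ ∧
        A *ᵥ Pi.single (Sum.inl 0) 1 = Pi.single (Sum.inl 0) 1)
    (fun _ => and_congr_left' mem_indefiniteOrthogonal_iff) fun X => ?_
  rw [forall_and, forall_transpose_exp_mul_mul_exp_eq_iff, forall_exp_mulVec_eq_iff,
    ← mem_skewAdjointMatricesSubmodule_iff_add_eq_zero]
  rfl

theorem mem_symmetricPart_indefiniteOrthogonal_iff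
    {X : Matrix (Fin p ⊕ Fin q) (Fin p ⊕ Fin q) ℝ} :
    X ∈ symmetricPart (indefiniteOrthogonal p q) ↔ ∃ B, X = fromBlocks 0 Bᵀ B 0 := by
  change X ∈ lieAlgebra _ ∧ Xᵀ = X ↔ _
  rw [lieAlgebra_indefiniteOrthogonal, mem_skewAdjointMatricesSubmodule_iff_add_eq_zero,
    indefiniteDiagonal_eq_fromBlocks]
  constructor
  · rintro ⟨hskew, hsymm⟩
    obtain ⟨A, B, C, D, rfl⟩ : ∃ A B C D, X = fromBlocks A B C D :=
      ⟨_, _, _, _, (fromBlocks_toBlocks X).symm⟩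
    rw [hsymm, fromBlocks_multiply, fromBlocks_multiply, fromBlocks_add, ← fromBlocks_zero,
      fromBlocks_inj] at hskew
    rw [fromBlocks_transpose, fromBlocks_inj] at hsymm
    have hA : A = 0 := by
      ext i j
      simpa using congrFun₂ hskew.1 i j
    have hD : D = 0 := by
      ext i j
      simpa [neg_add_eq_zero] using congrFun₂ hskew.2.2.2 i j
    exact ⟨C, by rw [hA, hD, hsymm.2.1]⟩
  · rintro ⟨B, rfl⟩
    simp [fromBlocks_multiply, fromBlocks_transpose, fromBlocks_add]

/-- The identification of `𝔭` for `O(p,q)` with the linear maps `ℝ^p → ℝ^q`, by taking the lower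
left block. -/
def symmetricPartEquiv :
    symmetricPart (indefiniteOrthogonal p q) ≃ₗ[ℝ] (Fin p → ℝ) →ₗ[ℝ] (Fin q → ℝ) where
  toFun X := toLin' X.1.toBlocks₂₁
  map_add' X Y := (toLin' (R := ℝ)).map_add X.1.toBlocks₂₁ Y.1.toBlocks₂₁
  map_smul' c X := (toLin' (R := ℝ)).map_smul c X.1.toBlocks₂₁
  invFun φ := ⟨fromBlocks 0 (LinearMap.toMatrix' φ)ᵀ (LinearMap.toMatrix' φ) 0,
    mem_symmetricPart_indefiniteOrthogonal_iff.mpr ⟨_, rfl⟩⟩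
  left_inv := by
    rintro ⟨X, hX⟩
    obtain ⟨B, rfl⟩ := mem_symmetricPart_indefiniteOrthogonal_iff.mp hX
    simp
  right_inv φ := by simp

theorem coe_mulVec_elim_zero (X : symmetricPart (indefiniteOrthogonal p q)) (v : Fin p → ℝ) :
    X.1 *ᵥ Sum.elim v (0 : Fin q → ℝ) = Sum.elim (0 : Fin p → ℝ) (symmetricPartEquiv X v) := by
  obtain ⟨X, hX⟩ := X
  obtain ⟨B, rfl⟩ := mem_symmetricPart_indefiniteOrthogonal_iff.mp hX
  rw [fromBlocks_mulVec]
  simp only [Sum.elim_comp_inl, Sum.elim_comp_inr, zero_mulVec, mulVec_zero, add_zero]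
  rfl

theorem indefiniteDiagonal_mulVec_eq_self_iff {x : Fin p ⊕ Fin q → ℝ} :
    indefiniteDiagonal (Fin p) (Fin q) ℝ *ᵥ x = x ↔
      x = Sum.elim (x ∘ Sum.inl) (0 : Fin q → ℝ) := by
  simp [funext_iff, indefiniteDiagonal, mulVec_diagonal, neg_eq_self]

theorem exists_fixedSubgroup_mulVec_eq (k : fixedSubgroup (indefiniteOrthogonal p q))
    (v : Fin p → ℝ) :
    ∃ w, (k : GL (Fin p ⊕ Fin q) ℝ).val *ᵥ Sum.elim v (0 : Fin q → ℝ) =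
      Sum.elim w (0 : Fin q → ℝ) := by
  have hcomm : indefiniteDiagonal (Fin p) (Fin q) ℝ * (k : GL (Fin p ⊕ Fin q) ℝ).val =
      (k : GL (Fin p ⊕ Fin q) ℝ).val * indefiniteDiagonal (Fin p) (Fin q) ℝ := by
    have hk : (k : GL (Fin p ⊕ Fin q) ℝ).val * (k : GL (Fin p ⊕ Fin q) ℝ).valᵀ = 1 :=
      Unitary.mul_star_self_of_mem (coe_mem_unitary k)
    conv_rhs => rw [← mem_indefiniteOrthogonal_iff.mp k.2.1]
    rw [← mul_assoc, ← mul_assoc, hk, one_mul]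
  refine ⟨_, indefiniteDiagonal_mulVec_eq_self_iff.mp ?_⟩
  rw [mulVec_mulVec, hcomm, ← mulVec_mulVec, indefiniteDiagonal_mulVec_eq_self_iff.mpr rfl]

theorem exists_fixedSubgroup_coe_eq_fromBlocks {A : Matrix (Fin p) (Fin p) ℝ}
    (hA : A ∈ orthogonalGroup (Fin p) ℝ) :
    ∃ k : fixedSubgroup (indefiniteOrthogonal p q),
      (k : GL (Fin p ⊕ Fin q) ℝ).val = fromBlocks A 0 0 1 := by
  have hl : Aᵀ * A = 1 := (mem_orthogonalGroup_iff' _ _).mp hA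
  have hr : A * Aᵀ = 1 := (mem_orthogonalGroup_iff _ _).mp hA
  refine ⟨⟨⟨fromBlocks A 0 0 1, fromBlocks Aᵀ 0 0 1, ?_, ?_⟩, ?_, ?_⟩, rfl⟩
  · simp [fromBlocks_multiply, hr]
  · simp [fromBlocks_multiply, hl]
  · rw [mem_indefiniteOrthogonal_iff, indefiniteDiagonal_eq_fromBlocks]
    simp [fromBlocks_multiply, fromBlocks_transpose, hl]
  · simp [fromBlocks_transpose]

theorem exists_mem_orthogonalGroup_mulVec_single {n : Type*} [Fintype n] [DecidableEq n] (i : n)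
    {v : EuclideanSpace ℝ n} (hv : ‖v‖ = 1) :
    ∃ A ∈ orthogonalGroup n ℝ, A *ᵥ Pi.single i 1 = v := by
  have horth : Orthonormal ℝ (({i} : Set n).domRestrict fun _ => v) :=
    ⟨fun _ => hv, fun _ _ hne => absurd (Subsingleton.elim _ _) hne⟩
  obtain ⟨b, hb⟩ := horth.exists_orthonormalBasis_extension_of_card_eq finrank_euclideanSpace
  refine ⟨_, (EuclideanSpace.basisFun n ℝ).toMatrix_orthonormalBasis_mem_orthogonal b, ?_⟩
  ext j
  simp [Module.Basis.toMatrix_apply, hb i rfl]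

theorem exists_fixedSubgroup_mulVec_single_eq {v : Fin (p + 1) → ℝ} (hv : v ≠ 0) :
    ∃ (k : fixedSubgroup (indefiniteOrthogonal (p + 1) q)) (c : ℝ), c ≠ 0 ∧
      (k : GL (Fin (p + 1) ⊕ Fin q) ℝ).val *ᵥ Pi.single (Sum.inl 0) 1 =
        Sum.elim (c • v) (0 : Fin q → ℝ) := by
  have hv' : WithLp.toLp 2 v ≠ 0 := by simpa using hv
  obtain ⟨A, hA, hAv⟩ :=
    exists_mem_orthogonalGroup_mulVec_single 0 (norm_smul_inv_norm (𝕜 := ℝ) hv')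
  obtain ⟨k, hk⟩ := exists_fixedSubgroup_coe_eq_fromBlocks (q := q) hA
  refine ⟨k, _, inv_ne_zero (norm_ne_zero_iff.mpr hv'), ?_⟩
  rw [hk, ← Sum.elim_single_zero, fromBlocks_mulVec]
  simp only [Sum.elim_comp_inl, Sum.elim_comp_inr, zero_mulVec, mulVec_zero, add_zero, hAv]
  rfl

theorem mem_map_Ad_tangentialSubmodule_iff {k : fixedSubgroup (indefiniteOrthogonal (p + 1) q)}
    {X : symmetricPart (indefiniteOrthogonal (p + 1) q)} :
    X ∈ (tangentialSubmodule _ (indefiniteOrthogonalStabilizer p q)).map (Ad _ k) ↔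
      X.1 *ᵥ (k : GL (Fin (p + 1) ⊕ Fin q) ℝ).val *ᵥ Pi.single (Sum.inl 0) 1 = 0 := by
  have hmem : (Ad _ k⁻¹ X).1 ∈
      skewAdjointMatricesSubmodule (indefiniteDiagonal (Fin (p + 1)) (Fin q) ℝ) :=
    lieAlgebra_indefiniteOrthogonal ▸ (Ad _ k⁻¹ X).2.1
  rw [mem_map_Ad_iff, tangentialSubmodule, Submodule.mem_comap,
    lieAlgebra_indefiniteOrthogonalStabilizer, Submodule.mem_inf, and_iff_right (by exact hmem)]
  change ((k : GL (Fin (p + 1) ⊕ Fin q) ℝ)⁻¹.val * X.1 *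
    (k : GL (Fin (p + 1) ⊕ Fin q) ℝ)⁻¹⁻¹.val) *ᵥ _ = 0 ↔ _
  rw [inv_inv, ← mulVec_mulVec, ← mulVec_mulVec, (mulVec_injective_of_isUnit
    (k : GL (Fin (p + 1) ⊕ Fin q) ℝ)⁻¹.isUnit).eq_iff' (mulVec_zero _)]

theorem map_Ad_tangentialSubmodule {k : fixedSubgroup (indefiniteOrthogonal (p + 1) q)}
    {v : Fin (p + 1) → ℝ} (hk : (k : GL (Fin (p + 1) ⊕ Fin q) ℝ).val *ᵥ Pi.single (Sum.inl 0) 1 =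
      Sum.elim v (0 : Fin q → ℝ)) :
    (tangentialSubmodule _ (indefiniteOrthogonalStabilizer p q)).map (Ad _ k) =
      (LinearMap.ker (LinearMap.applyₗ v)).comap
        (symmetricPartEquiv (p := p + 1) (q := q)).toLinearMap := by
  ext X
  rw [mem_map_Ad_tangentialSubmodule_iff, hk, coe_mulVec_elim_zero]
  simp [funext_iff]

theorem isCompl_map_Ad_tangentialSubmodule_iff
    {W : Submodule ℝ (symmetricPart (indefiniteOrthogonal (p + 1) q))}
    {k : fixedSubgroup (indefiniteOrthogonal (p + 1) q)} {v : Fin (p + 1) → ℝ}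
    (hk : (k : GL (Fin (p + 1) ⊕ Fin q) ℝ).val *ᵥ Pi.single (Sum.inl 0) 1 =
      Sum.elim v (0 : Fin q → ℝ)) :
    IsCompl W ((tangentialSubmodule _ (indefiniteOrthogonalStabilizer p q)).map (Ad _ k)) ↔
      IsCompl (Submodule.orderIsoMapComap symmetricPartEquiv W)
        (LinearMap.ker (LinearMap.applyₗ v)) := by
  rw [map_Ad_tangentialSubmodule hk, (Submodule.orderIsoMapComap symmetricPartEquiv).isCompl_iff]
  congr! 1
  exact Submodule.map_comap_eq_of_surjective symmetricPartEquiv.surjective _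

theorem forall_isCompl_map_Ad_iff
    {W : Submodule ℝ (symmetricPart (indefiniteOrthogonal (p + 1) q))} :
    (∀ k, IsCompl W
      ((tangentialSubmodule _ (indefiniteOrthogonalStabilizer p q)).map (Ad _ k))) ↔
      ∀ v ≠ 0, IsCompl (Submodule.orderIsoMapComap symmetricPartEquiv W)
        (LinearMap.ker (LinearMap.applyₗ v)) := by
  constructor
  · intro hW v hv
    obtain ⟨k, c, hc, hk⟩ := exists_fixedSubgroup_mulVec_single_eq (q := q) hv
    have hcompl := (isCompl_map_Ad_tangentialSubmodule_iff hk).mp (hW k)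
    rwa [map_smul, LinearMap.ker_smul _ _ hc] at hcompl
  · intro hW k
    obtain ⟨v, hk⟩ := exists_fixedSubgroup_mulVec_eq k (Pi.single 0 1)
    rw [Sum.elim_single_zero] at hk
    refine (isCompl_map_Ad_tangentialSubmodule_iff hk).mpr (hW v ?_)
    rintro rfl
    rw [Sum.elim_zero_zero] at hk
    have hzero := (mulVec_injective_of_isUnit k.1.isUnit).eq_iff' (mulVec_zero _) |>.mp hk
    exact one_ne_zero (Pi.single_eq_zero_iff.mp hzero)

end IndefiniteOrthogonal

end TangentialSpaceForm

end

theorem mainTheorem7 (p q : ℕ) :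
    TangentialSpaceForm.AdmitsCompactCliffordKleinForm
        (TangentialSpaceForm.tangentialSubgroup
          (TangentialSpaceForm.indefiniteOrthogonal (p + 1) q)
          (TangentialSpaceForm.indefiniteOrthogonalStabilizer p q)) ↔
      ∃ f : (Fin (p + 1) → ℝ) →ₗ[ℝ] (Fin q → ℝ) →ₗ[ℝ] (Fin q → ℝ),
        ∀ v w, f v w = 0 → v = 0 ∨ w = 0 := by
  have := TangentialSpaceForm.compactSpace_fixedSubgroup
    (TangentialSpaceForm.isClosed_indefiniteOrthogonal (p := p + 1) (q := q))
  rw [TangentialSpaceForm.admitsCompactCliffordKleinForm_tangentialSubgroup_iff,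
    ← TangentialSpaceForm.exists_isCompl_ker_applyₗ_iff]
  simp only [TangentialSpaceForm.forall_isCompl_map_Ad_iff]
  exact ((Submodule.orderIsoMapComap TangentialSpaceForm.symmetricPartEquiv).surjective.exists
    (p := fun W => ∀ v ≠ 0, IsCompl W (LinearMap.ker (LinearMap.applyₗ v)))).symm
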